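/- Let $N,J\ge 1$ be integers, let $T>0$ and $\gamma>0$ be real, put $\tau=T/N$ and $\eta=\gamma/\tau$, and let $L_h\in\mathbb{R}^{J\times J}$ be symmetric positive semidefinite. Let $B_1,B_2\in\mathbb{R}^{N\times N}$ be the lower bidiagonal matrices with all diagonal entries equal to $1$ and all entries on the first subdiagonal equal to $-1$ (for $B_1$) and to $1$ (for $B_2$), and let $B=B_2^{-1}B_1$. Let $q_k=2(-1)^k$ for $k\ge 1$, let $\tilde B\in\mathbb{R}^{N\times N}$ be the matrix with entries $\tilde B_{ij}=q_{N-(j-i)}$ for $i<j$ and $\tilde B_{ij}=0$ for $i\ge j$, and let $B_\alpha=B+\alpha\tilde B$. With $\otimes$ the Kronecker product and $I_m$ the $m\times m$ identity matrix, define $$G=2B\otimes I_J+\tau I_N\otimes L_h,\qquad \mathbf K=\tau I_{NJ}+\eta\,GG^{\mathrm T},$$ $$\mathbf R_\alpha=(\sqrt\tau I_N+2\sqrt\eta\,B_\alpha)\otimes I_J+\tau\sqrt\eta\,I_N\otimes L_h,\qquad \mathbf P_\alpha=\mathbf R_\alpha\mathbf R_\alpha^{\mathrm T}.$$ Suppose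 that $$0<\alpha\le\min\left\{\frac{\tau}{24\sqrt\gamma},\ \frac{\tau^{3/2}}{2\sqrt{6\gamma}\,T},\ \frac{\tau^2}{8\sqrt{3\gamma}\,T},\ \frac13\right\}.$$ Then $\mathbf K$ and $\mathbf P_\alpha$ are symmetric positive definite. Moreover, for every $b\in\mathbb{R}^{NJ}$, let $v$ be the solution of $\mathbf P_\alpha^{-1}\mathbf K v=\mathbf P_\alpha^{-1}b$, let $v^0\in\mathbb{R}^{NJ}$ be arbitrary, and let $v^k$ be the iterates of the preconditioned conjugate gradient (PCG) method with preconditioner $\mathbf P_\alpha$ for this system: $r^0=b-\mathbf K v^0$, $p^0=\mathbf P_\alpha^{-1}r^0$ and, for $k\ge 0$, with $z^k=\mathbf P_\alpha^{-1}r^k$, $$a_k=\frac{(r^k)^{\mathrm T}z^k}{(p^k)^{\mathrm T}\mathbf K p^k},\quad v^{k+1}=v^k+a_kp^k,\quad r^{k+1}=r^k-a_k\mathbf K p^k,\quad p^{k+1}=z^{k+1}+\frac{(r^{k+1})^{\mathrm T}z^{k+1}}{(r^k)^{\mathrm T}z^k}\,p^k$$ (once $r^k=0$, the method has terminated and $v^m=v^k$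 for all $m\ge k$). Then, with $\|x\|_{\mathbf K}=(x^{\mathrm T}\mathbf K x)^{1/2}$, $$\|v^k-v\|_{\mathbf K}\le\frac{2}{3^k}\,\|v^0-v\|_{\mathbf K}\qquad\text{for all integers }k\ge 0.$$ In particular, the convergence rate is independent of the matrix size $NJ$ and of the regularization parameter $\gamma$. -/

import Mathlib

open scoped Matrix Kronecker

namespace TimeParallelPCG

/-! ### Time-stepping matrices (Crank-Nicolson) -/

/-- The `N × N` lower bidiagonal matrix with `1` on the diagonal and `-1` just below it. -/
def B₁ (N : ℕ) : Matrix (Fin N) (Fin N) ℝ :=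
  Matrix.of fun i j =>
    if (i : ℕ) = (j : ℕ) then 1 else if (i : ℕ) = (j : ℕ) + 1 then -1 else 0

/-- The `N × N` lower bidiagonal matrix with `1` on the diagonal and `1` just below it. -/
def B₂ (N : ℕ) : Matrix (Fin N) (Fin N) ℝ :=
  Matrix.of fun i j =>
    if (i : ℕ) = (j : ℕ) then 1 else if (i : ℕ) = (j : ℕ) + 1 then 1 else 0

/-- `B₂` has determinant `1`, so `(B₂ N)⁻¹` below is a genuine inverse. -/
theorem det_B₂ (N : ℕ) : (B₂ N).det = 1 := by
  rw [Matrix.det_of_isLowerTriangular]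
  · simp [B₂]
  · intro i j hij
    have h : (i : ℕ) < (j : ℕ) := hij
    simp only [B₂, Matrix.of_apply]
    rw [if_neg (by omega), if_neg (by omega)]

/-- `B = B₂⁻¹ B₁`. -/
noncomputable def B (N : ℕ) : Matrix (Fin N) (Fin N) ℝ := (B₂ N)⁻¹ * B₁ N

/-- `q₀ = 1` and `q_k = 2 (-1)^k` for `k ≥ 1`. -/
def q (k : ℕ) : ℝ := if k = 0 then 1 else 2 * (-1) ^ k

/-- The strictly upper triangular Toeplitz matrix whose `(i, j)` entry is `q_{N-(j-i)}` for
`i < j`: its first row is `(0, q_{N-1}, …, q_1)`. -/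
def Btilde (N : ℕ) : Matrix (Fin N) (Fin N) ℝ :=
  Matrix.of fun i j => if (i : ℕ) < (j : ℕ) then q (N - ((j : ℕ) - (i : ℕ))) else 0

/-- `B_α = B + α B̃`. -/
noncomputable def Balpha (N : ℕ) (α : ℝ) : Matrix (Fin N) (Fin N) ℝ := B N + α • Btilde N

/-! ### The Schur complement and its preconditioner

`τ` is the time step, `γ` the regularization parameter, `η = γ / τ`, and `L` the `J × J` matrix of
the spatial discretization. Rows and columns of the `NJ × NJ` matrices are indexed by pairs. -/

/-- `G = 2 B ⊗ I_J + τ I_N ⊗ L`. -/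
noncomputable def G (N J : ℕ) (τ : ℝ) (L : Matrix (Fin J) (Fin J) ℝ) :
    Matrix (Fin N × Fin J) (Fin N × Fin J) ℝ :=
  ((2 : ℝ) • B N) ⊗ₖ (1 : Matrix (Fin J) (Fin J) ℝ)
    + τ • ((1 : Matrix (Fin N) (Fin N) ℝ) ⊗ₖ L)

/-- `K = τ I_{NJ} + η G Gᵀ` with `η = γ / τ`. -/
noncomputable def K (N J : ℕ) (τ γ : ℝ) (L : Matrix (Fin J) (Fin J) ℝ) :
    Matrix (Fin N × Fin J) (Fin N × Fin J) ℝ :=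
  τ • (1 : Matrix (Fin N × Fin J) (Fin N × Fin J) ℝ) + (γ / τ) • (G N J τ L * (G N J τ L)ᵀ)

/-- `R_α = (√τ I_N + 2 √η B_α) ⊗ I_J + τ √η I_N ⊗ L` with `η = γ / τ`. -/
noncomputable def Ralpha (N J : ℕ) (τ γ α : ℝ) (L : Matrix (Fin J) (Fin J) ℝ) :
    Matrix (Fin N × Fin J) (Fin N × Fin J) ℝ :=
  (√τ • (1 : Matrix (Fin N) (Fin N) ℝ) + (2 * √(γ / τ)) • Balpha N α)
      ⊗ₖ (1 : Matrix (Fin J) (Fin J) ℝ)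
    + (τ * √(γ / τ)) • ((1 : Matrix (Fin N) (Fin N) ℝ) ⊗ₖ L)

/-- `P_α = R_α R_αᵀ`. -/
noncomputable def Palpha (N J : ℕ) (τ γ α : ℝ) (L : Matrix (Fin J) (Fin J) ℝ) :
    Matrix (Fin N × Fin J) (Fin N × Fin J) ℝ :=
  Ralpha N J τ γ α L * (Ralpha N J τ γ α L)ᵀ

/-! ### The preconditioned conjugate gradient method -/

/-- The norm `‖x‖_A = (xᵀ A x)^{1/2}` (a norm when `A` is positive definite). -/
noncomputable def energyNorm {n : Type*} [Fintype n] (A : Matrix n n ℝ) (x : n → ℝ) : ℝ :=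
  √(x ⬝ᵥ A *ᵥ x)

/-- The data carried by one PCG iteration: iterate, residual and search direction. -/
structure PCGState (n : Type*) where
  /-- current iterate -/
  x : n → ℝ
  /-- current (unpreconditioned) residual -/
  r : n → ℝ
  /-- current search direction -/
  p : n → ℝ

/-- Start of PCG for `A x = b` with preconditioner `M`: `r⁰ = b - A x⁰`, `p⁰ = M⁻¹ r⁰`. -/
noncomputable def pcgInit {n : Type*} [Fintype n] [DecidableEq n]
    (M A : Matrix n n ℝ) (b x₀ : n → ℝ) : PCGState n where
  x := x₀
  r := b - A *ᵥ x₀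
  p := M⁻¹ *ᵥ (b - A *ᵥ x₀)

/-- One PCG step. With `z = M⁻¹ r`:
`a = (rᵀ z) / (pᵀ A p)`, `x⁺ = x + a p`, `r⁺ = r - a A p`, `z⁺ = M⁻¹ r⁺`,
`β = (r⁺ᵀ z⁺) / (rᵀ z)`, `p⁺ = z⁺ + β p`.
When the method has terminated (`r = 0`) the convention `0 / 0 = 0` keeps the iterate
unchanged, see `pcgStep_of_r_eq_zero`. -/
noncomputable def pcgStep {n : Type*} [Fintype n] [DecidableEq n]
    (M A : Matrix n n ℝ) (s : PCGState n) : PCGState n :=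
  let z := M⁻¹ *ᵥ s.r
  let a := (s.r ⬝ᵥ z) / (s.p ⬝ᵥ A *ᵥ s.p)
  let r' := s.r - a • (A *ᵥ s.p)
  let z' := M⁻¹ *ᵥ r'
  let β := (r' ⬝ᵥ z') / (s.r ⬝ᵥ z)
  { x := s.x + a • s.p
    r := r'
    p := z' + β • s.p }

/-- After termination PCG stays at the exact solution it has found. -/
theorem pcgStep_of_r_eq_zero {n : Type*} [Fintype n] [DecidableEq n]
    (M A : Matrix n n ℝ) (s : PCGState n) (hs : s.r = 0) :
    (pcgStep M A s).x = s.x ∧ (pcgStep M A s).r = 0 := by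
  simp [pcgStep, hs]

/-- The `k`th iterate `xᵏ` of PCG with preconditioner `M` for the preconditioned system
`M⁻¹ A x = M⁻¹ b`, started at `x⁰ = x₀`. -/
noncomputable def pcgIterate {n : Type*} [Fintype n] [DecidableEq n]
    (M A : Matrix n n ℝ) (b x₀ : n → ℝ) (k : ℕ) : n → ℝ :=
  ((pcgStep M A)^[k] (pcgInit M A b x₀)).x

end TimeParallelPCG

/-!
Write `|·|` for the Euclidean norm and put `η = γ / τ`. The `K`-energy of `x` is `|a|² + |g|²` with
`a = √τ x` and `g = √η Gᵀ x`, and its `P_α`-energy is `|R_αᵀ x|² = |a + g + e|²`, where `e` is the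
contribution of `α B̃`.

* The matrix `B` is the Cayley transform `(1 + S)⁻¹ (1 - S)` of the shift `S`, which is a
  contraction. Hence `B + Bᵀ` is positive semidefinite, so is `G + Gᵀ`, and `a ⬝ g ≥ 0`
  (`G_dotProduct_nonneg`).
* The Frobenius norm of `B̃` is at most `√2 N`, so the bound `α ≤ τ² / (8 √(3γ) T)` gives
  `|e|² ≤ |a|² / 24`.
* Young's inequality (`perturbed_sum_bounds`) turns these two facts into
  `(19/24)² K ≤ P_α ≤ 4 (19/24)² K` as quadratic forms (`Palpha_bounds`): the condition number of
  `P_α⁻¹ K` is at most `4`, for which `(√κ - 1) / (√κ + 1) = 1/3`.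

It remains to prove the Chebyshev estimate for the preconditioned conjugate gradient method. The
usual orthogonality relations (`pcgOrthogonal`) show that the error `e_k` is `K`-orthogonal to the
span of the first `k` search directions. With `f` the affine image of `P⁻¹ K` whose spectrum lies in
`[-1, 1]`, and `σ` the affine image of `0`, the vector `T_k(f) e₀` differs from `T_k(σ) e_k` by an
element of that span. Therefore `T_k(σ) ‖e_k‖ ≤ ‖T_k(f) e₀‖ ≤ ‖e₀‖` in the energy norm, where the
last step uses the Pell identity `T_k² + (1 - X²) U_{k-1}² = 1` in place of the spectral theorem. For
condition number `4` one has `σ = 5/3` and `T_k(σ) = (3^k + 3^{-k}) / 2`.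
-/

/-! ### Chebyshev polynomials of a contraction -/

namespace TimeParallelPCG

open Polynomial Polynomial.Chebyshev

/-- The Pell identity for Chebyshev polynomials. -/
theorem chebyshev_T_sq_add (n : ℕ) :
    T ℝ (n + 1) ^ 2 + (1 - X ^ 2) * U ℝ n ^ 2 = 1 := by
  have key : ∀ n : ℕ, U ℝ (n + 1) ^ 2 - 2 * X * U ℝ (n + 1) * U ℝ n + U ℝ n ^ 2 = 1 := by
    intro n
    induction n with
    | zero => simp; ring
    | succ n ih =>
      have h := U_add_two ℝ (n : ℤ)
      push_cast
      rw [show (n : ℤ) + 1 + 1 = n + 2 by ring, h]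
      linear_combination ih
  have h := T_eq_U_sub_X_mul_U ℝ ((n : ℤ) + 1)
  rw [add_sub_cancel_right] at h
  rw [h]
  linear_combination key n

variable {V : Type*} [AddCommGroup V] [Module ℝ V]

theorem bilin_aeval_comm (E : LinearMap.BilinForm ℝ V) (f : Module.End ℝ V)
    (hf : ∀ v w, E (f v) w = E v (f w)) (p : ℝ[X]) (v w : V) :
    E (aeval f p v) w = E v (aeval f p w) := by
  induction p using Polynomial.induction_on' generalizing v w with
  | add p q hp hq => simp [hp, hq]
  | monomial n c =>
    induction n generalizing v w with
    | zero => simp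
    | succ n ih =>
      simp only [aeval_monomial, pow_succ, Module.End.mul_apply, Module.algebraMap_end_apply,
        map_smul, LinearMap.smul_apply] at ih ⊢
      rw [ih, hf, ← Module.End.mul_apply, ← pow_succ', pow_succ, Module.End.mul_apply]

/-- The operator analogue of `|T k x| ≤ 1` for `|x| ≤ 1`. It follows from the Pell identity, so no
spectral theorem is needed. -/
theorem bilin_aeval_chebyshev_T_le (E : LinearMap.BilinForm ℝ V) (f : Module.End ℝ V)
    (hf : ∀ v w, E (f v) w = E v (f w)) (hle : ∀ v, E (f v) (f v) ≤ E v v) (k : ℕ) (v : V) :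
    E (aeval f (T ℝ k) v) (aeval f (T ℝ k) v) ≤ E v v := by
  cases k with
  | zero => simp
  | succ n =>
    have h := congrArg (fun p => E (aeval f p v) v) (chebyshev_T_sq_add n)
    simp only [map_add, map_mul, map_sub, aeval_X, map_one, pow_two, sub_mul, one_mul,
      Module.End.mul_apply, LinearMap.add_apply, LinearMap.sub_apply, Module.End.one_apply] at h
    have h1 := hle (aeval f (U ℝ n) v)
    have h2 := bilin_aeval_comm E f hf (T ℝ (n + 1)) (aeval f (T ℝ (n + 1)) v) v
    have h3 := bilin_aeval_comm E f hf (U ℝ n) (aeval f (U ℝ n) v) v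
    -- `f` and `aeval f (U ℝ n)` commute, both being polynomials in `f`
    have h4 : f (f (aeval f (U ℝ n) (aeval f (U ℝ n) v)))
        = aeval f (U ℝ n) (f (f (aeval f (U ℝ n) v))) := by
      have := congrArg (fun p => aeval f p (aeval f (U ℝ n) v))
        (show X * X * U ℝ n = U ℝ n * (X * X) by ring)
      simpa using this
    rw [h3, h4, bilin_aeval_comm E f hf (U ℝ n) (f (f _)), hf] at h
    push_cast
    linarith

/-- If a self-adjoint `f` has spectrum in `[a, b]`, the affine image of `f` with spectrum in
`[-1, 1]` is a contraction. -/
theorem bilin_affine_contraction (E : LinearMap.BilinForm ℝ V) (f : Module.End ℝ V)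
    (hs : ∀ v w, E v w = E w v) (hf : ∀ v w, E (f v) w = E v (f w)) {a b : ℝ} (hab : a < b)
    (ha : ∀ v, a * E v v ≤ E (f v) v) (hb : ∀ v, E (f v) v ≤ b * E v v) (v : V) :
    E (((b + a) / (b - a)) • v - (2 / (b - a)) • f v)
      (((b + a) / (b - a)) • v - (2 / (b - a)) • f v) ≤ E v v := by
  have hd : 0 < b - a := sub_pos.2 hab
  -- `(b - a) (f - a) (b - f) = (b - f) (f - a) ^ 2 + (f - a) (b - f) ^ 2`
  have h1 := hb (f v - a • v)
  have h2 := ha (b • v - f v)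
  have e1 := hs v (f v)
  have e2 := hf (f v) v
  have e3 := hs (f v) (f (f v))
  have e4 := hs v (f (f v))
  simp only [map_sub, map_smul, LinearMap.sub_apply, LinearMap.smul_apply, smul_eq_mul] at h1 h2 ⊢
  rw [e1, e2] at h1 h2
  rw [e1]
  have hprod : 0 ≤ (b - a) * ((b + a) * E (f v) v - E (f v) (f v) - a * b * E v v) := by
    linarith
  have hq := nonneg_of_mul_nonneg_right hprod hd
  have : E v v - (((b + a) / (b - a)) * (((b + a) / (b - a)) * E v v - (2 / (b - a)) * E (f v) v)
      - (2 / (b - a)) * (((b + a) / (b - a)) * E (f v) v - (2 / (b - a)) * E (f v) (f v)))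
      = 4 / (b - a) ^ 2 * ((b + a) * E (f v) v - E (f v) (f v) - a * b * E v v) := by
    field_simp
    ring
  have h4 : 0 ≤ 4 / (b - a) ^ 2 * ((b + a) * E (f v) v - E (f v) (f v) - a * b * E v v) := by
    positivity
  linarith

/-- `T k (5 / 3) = (3 ^ k + 3 ^ (-k)) / 2`. -/
theorem chebyshev_T_eval_five_thirds (k : ℕ) :
    (T ℝ k).eval (5 / 3) = ((3 : ℝ) ^ k + (1 / 3) ^ k) / 2 := by
  induction k using Nat.twoStepInduction with
  | zero => simp
  | one => simp; norm_num
  | more n h0 h1 =>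
    push_cast at h1 ⊢
    rw [T_add_two]
    simp only [eval_sub, eval_mul, eval_X, eval_ofNat, h0, h1]
    ring

end TimeParallelPCG

/-! ### Orthogonality and optimality of the conjugate gradient iterates -/

namespace TimeParallelPCG

theorem transpose_eq_of_posDef {n : Type*} {A : Matrix n n ℝ} (hA : A.PosDef) : Aᵀ = A := by
  simpa using hA.isHermitian.eq

variable {n : Type*} [Fintype n]

theorem dotProduct_mulVec_symm {A : Matrix n n ℝ} (hA : Aᵀ = A) (x y : n → ℝ) :
    x ⬝ᵥ A *ᵥ y = y ⬝ᵥ A *ᵥ x := by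
  rw [Matrix.dotProduct_mulVec, ← Matrix.mulVec_transpose, hA, dotProduct_comm]

theorem posDef_dotProduct_pos {A : Matrix n n ℝ} (hA : A.PosDef) {x : n → ℝ} (hx : x ≠ 0) :
    0 < x ⬝ᵥ A *ᵥ x := by
  simpa using hA.dotProduct_mulVec_pos hx

theorem posDef_dotProduct_nonneg {A : Matrix n n ℝ} (hA : A.PosDef) (x : n → ℝ) :
    0 ≤ x ⬝ᵥ A *ᵥ x := by
  simpa using hA.posSemidef.dotProduct_mulVec_nonneg x

variable [DecidableEq n]

/-- The state of the conjugate gradient method after `k` steps. -/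
noncomputable def pcgState (M A : Matrix n n ℝ) (b x₀ : n → ℝ) (k : ℕ) : PCGState n :=
  (pcgStep M A)^[k] (pcgInit M A b x₀)

theorem pcgState_succ (M A : Matrix n n ℝ) (b x₀ : n → ℝ) (k : ℕ) :
    pcgState M A b x₀ (k + 1) = pcgStep M A (pcgState M A b x₀ k) :=
  Function.iterate_succ_apply' ..

/-- The step length `(rᵀ M⁻¹ r) / (pᵀ A p)` of a conjugate gradient step from the state `s`. -/
noncomputable def stepLength (M A : Matrix n n ℝ) (s : PCGState n) : ℝ :=
  (s.r ⬝ᵥ M⁻¹ *ᵥ s.r) / (s.p ⬝ᵥ A *ᵥ s.p)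

theorem pcgState_residual (M A : Matrix n n ℝ) (b x₀ : n → ℝ) (k : ℕ) :
    (pcgState M A b x₀ k).r = b - A *ᵥ (pcgState M A b x₀ k).x := by
  induction k with
  | zero => rfl
  | succ k ih =>
    rw [pcgState_succ]
    simp only [pcgStep, Matrix.mulVec_add, Matrix.mulVec_smul, ih]
    abel

section

variable {M A : Matrix n n ℝ} {b x₀ : n → ℝ}

theorem pcgState_x_succ (k : ℕ) : (pcgState M A b x₀ (k + 1)).x
    = (pcgState M A b x₀ k).x
      + stepLength M A (pcgState M A b x₀ k) • (pcgState M A b x₀ k).p := by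
  rw [pcgState_succ]; rfl

theorem pcgState_r_succ (k : ℕ) : (pcgState M A b x₀ (k + 1)).r
    = (pcgState M A b x₀ k).r
      - stepLength M A (pcgState M A b x₀ k) • A *ᵥ (pcgState M A b x₀ k).p := by
  rw [pcgState_succ]; rfl

theorem pcgState_p_succ (k : ℕ) : (pcgState M A b x₀ (k + 1)).p
    = M⁻¹ *ᵥ (pcgState M A b x₀ (k + 1)).r
      + (((pcgState M A b x₀ (k + 1)).r ⬝ᵥ M⁻¹ *ᵥ (pcgState M A b x₀ (k + 1)).r)
          / ((pcgState M A b x₀ k).r ⬝ᵥ M⁻¹ *ᵥ (pcgState M A b x₀ k).r))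
        • (pcgState M A b x₀ k).p := by
  rw [pcgState_succ]; rfl

theorem pcgState_r_eq_zero_of_le {j k : ℕ} (hjk : j ≤ k) (h : (pcgState M A b x₀ j).r = 0) :
    (pcgState M A b x₀ k).r = 0 := by
  induction k, hjk using Nat.le_induction with
  | base => exact h
  | succ k _ ih => rw [pcgState_succ]; exact (pcgStep_of_r_eq_zero M A _ ih).2

/-- The orthogonality relations of the conjugate gradient method that hold after `k` steps: the
search directions are `A`-conjugate, and the residual is orthogonal to the earlier search
directions and `M⁻¹`-orthogonal to the earlier residuals. -/
structure PCGOrthogonal (M A : Matrix n n ℝ) (b x₀ : n → ℝ) (k : ℕ) : Prop where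
  conj : ∀ j < k, (pcgState M A b x₀ j).p ⬝ᵥ A *ᵥ (pcgState M A b x₀ k).p = 0
  res_dir : ∀ j < k, (pcgState M A b x₀ k).r ⬝ᵥ (pcgState M A b x₀ j).p = 0
  res_res : ∀ j < k, (pcgState M A b x₀ k).r ⬝ᵥ M⁻¹ *ᵥ (pcgState M A b x₀ j).r = 0
  res_self : (pcgState M A b x₀ k).r ⬝ᵥ (pcgState M A b x₀ k).p
    = (pcgState M A b x₀ k).r ⬝ᵥ M⁻¹ *ᵥ (pcgState M A b x₀ k).r
  dir_ne : ∀ j < k, (pcgState M A b x₀ j).p ≠ 0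

theorem PCGOrthogonal.p_ne_zero (hM : M.PosDef) {k : ℕ} (h : PCGOrthogonal M A b x₀ k)
    (hr : (pcgState M A b x₀ k).r ≠ 0) : (pcgState M A b x₀ k).p ≠ 0 := by
  intro hp
  have h1 := posDef_dotProduct_pos hM.inv hr
  rw [← h.res_self, hp, dotProduct_zero] at h1
  exact h1.false

theorem pcgOrthogonal (hM : M.PosDef) (hA : A.PosDef) (k : ℕ)
    (hr : ∀ j < k, (pcgState M A b x₀ j).r ≠ 0) : PCGOrthogonal M A b x₀ k := by
  have hAs := transpose_eq_of_posDef hA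
  have hMs := transpose_eq_of_posDef hM.inv
  induction k with
  | zero => exact ⟨by simp, by simp, by simp, rfl, by simp⟩
  | succ k ih =>
    have I := ih fun j hj => hr j (hj.trans k.lt_succ_self)
    have hp : ∀ j ≤ k, (pcgState M A b x₀ j).p ≠ 0 := by
      intro j hj
      rcases hj.lt_or_eq with hj | rfl
      · exact I.dir_ne j hj
      · exact I.p_ne_zero hM (hr j j.lt_succ_self)
    have hpAp : ∀ j ≤ k, 0 < (pcgState M A b x₀ j).p ⬝ᵥ A *ᵥ (pcgState M A b x₀ j).p :=
      fun j hj => posDef_dotProduct_pos hA (hp j hj)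
    have hrz : ∀ j ≤ k, 0 < (pcgState M A b x₀ j).r ⬝ᵥ M⁻¹ *ᵥ (pcgState M A b x₀ j).r :=
      fun j hj => posDef_dotProduct_pos hM.inv (hr j (Nat.lt_succ_of_le hj))
    have hstep : ∀ j ≤ k, stepLength M A (pcgState M A b x₀ j) ≠ 0 :=
      fun j hj => (div_pos (hrz j hj) (hpAp j hj)).ne'
    have hrp : ∀ j ≤ k, (pcgState M A b x₀ (k + 1)).r ⬝ᵥ (pcgState M A b x₀ j).p = 0 := by
      intro j hj
      rw [pcgState_r_succ, sub_dotProduct, smul_dotProduct, dotProduct_comm (A *ᵥ _), smul_eq_mul]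
      rcases hj.lt_or_eq with hj | rfl
      · rw [I.res_dir j hj, I.conj j hj]; simp
      · rw [I.res_self, stepLength, div_mul_cancel₀ _ (hpAp j le_rfl).ne', sub_self]
    have hrr : ∀ j ≤ k, (pcgState M A b x₀ (k + 1)).r ⬝ᵥ M⁻¹ *ᵥ (pcgState M A b x₀ j).r = 0 := by
      intro j hj
      cases j with
      | zero => exact hrp 0 hj
      | succ j =>
        rw [eq_sub_of_add_eq (pcgState_p_succ j).symm, dotProduct_sub, dotProduct_smul, hrp _ hj, hrp _ (by omega)]
        simp
    -- the recurrence for the residuals expresses `A p_j` by `r_j` and `r_{j+1}`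
    have hAp : ∀ (y : n → ℝ) (j : ℕ), stepLength M A (pcgState M A b x₀ j)
        * ((pcgState M A b x₀ j).p ⬝ᵥ A *ᵥ (M⁻¹ *ᵥ y))
        = y ⬝ᵥ M⁻¹ *ᵥ (pcgState M A b x₀ j).r - y ⬝ᵥ M⁻¹ *ᵥ (pcgState M A b x₀ (j + 1)).r := by
      intro y j
      rw [pcgState_r_succ, Matrix.mulVec_sub, dotProduct_sub, sub_sub_cancel,
        dotProduct_mulVec_symm hMs, dotProduct_mulVec_symm hAs, smul_dotProduct, dotProduct_comm,
        smul_eq_mul]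
    refine ⟨fun j hj => ?_, fun j hj => hrp j (Nat.le_of_lt_succ hj),
      fun j hj => hrr j (Nat.le_of_lt_succ hj), ?_, fun j hj => hp j (Nat.le_of_lt_succ hj)⟩
    · have hj := Nat.le_of_lt_succ hj
      refine (mul_eq_zero.1 ?_).resolve_left (hstep j hj)
      have h1 := hAp (pcgState M A b x₀ (k + 1)).r j
      rw [hrr j hj] at h1
      rw [pcgState_p_succ, Matrix.mulVec_add, dotProduct_add, mul_add, h1, Matrix.mulVec_smul,
        dotProduct_smul, smul_eq_mul]
      rcases hj.lt_or_eq with hj | rfl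
      · rw [hrr (j + 1) hj, I.conj j hj]; simp
      · have h2 := (hpAp j le_rfl).ne'
        have h3 := (hrz j le_rfl).ne'
        rw [stepLength]
        field_simp
        ring
    · rw [pcgState_p_succ, dotProduct_add, dotProduct_smul, hrp k le_rfl]
      simp

/-- The span of the first `k` search directions; it is the Krylov space
`span {(M⁻¹ A) ^ i M⁻¹ r⁰ | i < k}` as long as the method has not terminated. -/
noncomputable def searchSpace (M A : Matrix n n ℝ) (b x₀ : n → ℝ) (k : ℕ) : Submodule ℝ (n → ℝ) :=
  Submodule.span ℝ {y | ∃ j < k, (pcgState M A b x₀ j).p = y}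

theorem searchSpace_mono {j k : ℕ} (h : j ≤ k) :
    searchSpace M A b x₀ j ≤ searchSpace M A b x₀ k :=
  Submodule.span_mono fun _ ⟨i, hi, e⟩ => ⟨i, hi.trans_le h, e⟩

theorem p_mem_searchSpace {j k : ℕ} (h : j < k) :
    (pcgState M A b x₀ j).p ∈ searchSpace M A b x₀ k :=
  Submodule.subset_span ⟨j, h, rfl⟩

theorem precond_r_mem_searchSpace {j k : ℕ} (h : j < k) :
    M⁻¹ *ᵥ (pcgState M A b x₀ j).r ∈ searchSpace M A b x₀ k := by
  cases j with
  | zero => exact p_mem_searchSpace h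
  | succ j =>
    rw [eq_sub_of_add_eq (pcgState_p_succ j).symm]
    exact sub_mem (p_mem_searchSpace h)
      (Submodule.smul_mem _ _ (p_mem_searchSpace (j.lt_succ_self.trans h)))

theorem x_sub_mem_searchSpace (k : ℕ) :
    (pcgState M A b x₀ k).x - x₀ ∈ searchSpace M A b x₀ k := by
  induction k with
  | zero => simp [pcgState, pcgInit]
  | succ k ih =>
    rw [pcgState_x_succ, add_sub_right_comm]
    exact add_mem (searchSpace_mono k.le_succ ih)
      (Submodule.smul_mem _ _ (p_mem_searchSpace k.lt_succ_self))

/-- `M⁻¹ A` maps the span of the first `k` search directions into that of the first `k + 1`. -/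
theorem mulVec_mem_searchSpace (hM : M.PosDef) (hA : A.PosDef) {k : ℕ}
    (hr : ∀ j < k, (pcgState M A b x₀ j).r ≠ 0) {y : n → ℝ} (hy : y ∈ searchSpace M A b x₀ k) :
    M⁻¹ *ᵥ (A *ᵥ y) ∈ searchSpace M A b x₀ (k + 1) := by
  induction hy using Submodule.span_induction with
  | mem y hy =>
    obtain ⟨j, hj, rfl⟩ := hy
    have I := pcgOrthogonal (b := b) (x₀ := x₀) hM hA j fun i hi => hr i (hi.trans hj)
    have ha : stepLength M A (pcgState M A b x₀ j) ≠ 0 :=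
      (div_pos (posDef_dotProduct_pos hM.inv (hr j hj))
        (posDef_dotProduct_pos hA (I.p_ne_zero hM (hr j hj)))).ne'
    rw [← Submodule.smul_mem_iff _ ha, ← Matrix.mulVec_smul, ← sub_sub_self (pcgState M A b x₀ j).r
      (_ • A *ᵥ _), ← pcgState_r_succ, Matrix.mulVec_sub]
    exact sub_mem (precond_r_mem_searchSpace (by omega)) (precond_r_mem_searchSpace (by omega))
  | zero => simp
  | add x y _ _ hx hy => simpa only [Matrix.mulVec_add] using add_mem hx hy
  | smul c x _ hx => simpa only [Matrix.mulVec_smul] using Submodule.smul_mem _ c hx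

/-- The error of the `k`th iterate is `A`-orthogonal to the search space. -/
theorem error_orthogonal (hM : M.PosDef) (hA : A.PosDef) {k : ℕ}
    (hr : ∀ j < k, (pcgState M A b x₀ j).r ≠ 0) {x y : n → ℝ} (hx : A *ᵥ x = b)
    (hy : y ∈ searchSpace M A b x₀ k) : y ⬝ᵥ A *ᵥ ((pcgState M A b x₀ k).x - x) = 0 := by
  have he : A *ᵥ ((pcgState M A b x₀ k).x - x) = -(pcgState M A b x₀ k).r := by
    rw [pcgState_residual, Matrix.mulVec_sub, hx, neg_sub]
  rw [he]
  induction hy using Submodule.span_induction with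
  | mem y hy =>
    obtain ⟨j, hj, rfl⟩ := hy
    rw [dotProduct_neg, dotProduct_comm, (pcgOrthogonal hM hA k hr).res_dir j hj, neg_zero]
  | zero => simp
  | add x y _ _ hx hy => rw [add_dotProduct, hx, hy, add_zero]
  | smul c x _ hx => rw [smul_dotProduct, hx, smul_zero]

end

end TimeParallelPCG

/-! ### Convergence of the preconditioned conjugate gradient method -/

namespace TimeParallelPCG

open Polynomial Polynomial.Chebyshev

variable {n : Type*} [Fintype n] [DecidableEq n] {M A : Matrix n n ℝ} {a c : ℝ}

/-- A lower bound on the generalized Rayleigh quotient of `(A, M)` bounds `M⁻¹ A` from below in the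
energy inner product. -/
theorem precond_lower_bound (hM : M.PosDef) (ha₀ : 0 < a)
    (ha : ∀ y, a * (y ⬝ᵥ M *ᵥ y) ≤ y ⬝ᵥ A *ᵥ y) (v : n → ℝ) :
    a * (v ⬝ᵥ A *ᵥ v) ≤ (M⁻¹ *ᵥ (A *ᵥ v)) ⬝ᵥ A *ᵥ v := by
  set u := M⁻¹ *ᵥ (A *ᵥ v)
  have hu : M *ᵥ u = A *ᵥ v := by
    rw [Matrix.mulVec_mulVec,
      Matrix.mul_nonsing_inv _ ((Matrix.isUnit_iff_isUnit_det _).1 hM.isUnit), Matrix.one_mulVec]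
  -- nonnegativity of the `M`-energy of `u - a v`
  have h := posDef_dotProduct_nonneg hM (u - a • v)
  have h1 : v ⬝ᵥ M *ᵥ u = v ⬝ᵥ A *ᵥ v := by rw [hu]
  have h2 := dotProduct_mulVec_symm (transpose_eq_of_posDef hM) u v
  have h3 : u ⬝ᵥ M *ᵥ u = u ⬝ᵥ A *ᵥ v := by rw [hu]
  simp only [Matrix.mulVec_sub, Matrix.mulVec_smul, dotProduct_sub, sub_dotProduct,
    dotProduct_smul, smul_dotProduct, smul_eq_mul, h2, h1, h3] at h
  nlinarith [ha v]

/-- An upper bound on the generalized Rayleigh quotient of `(A, M)` bounds `M⁻¹ A` from above in the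
energy inner product. -/
theorem precond_upper_bound (hM : M.PosDef) (hA : A.PosDef) (hc₀ : 0 < c)
    (hc : ∀ y, y ⬝ᵥ A *ᵥ y ≤ c * (y ⬝ᵥ M *ᵥ y)) (v : n → ℝ) :
    (M⁻¹ *ᵥ (A *ᵥ v)) ⬝ᵥ A *ᵥ v ≤ c * (v ⬝ᵥ A *ᵥ v) := by
  set u := M⁻¹ *ᵥ (A *ᵥ v)
  have hu : M *ᵥ u = A *ᵥ v := by
    rw [Matrix.mulVec_mulVec,
      Matrix.mul_nonsing_inv _ ((Matrix.isUnit_iff_isUnit_det _).1 hM.isUnit), Matrix.one_mulVec]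
  -- nonnegativity of the `A`-energy of `u - c v`
  have h := posDef_dotProduct_nonneg hA (u - c • v)
  have h2 := dotProduct_mulVec_symm (transpose_eq_of_posDef hA) u v
  have h3 := hc u
  rw [hu] at h3
  simp only [Matrix.mulVec_sub, Matrix.mulVec_smul, dotProduct_sub, sub_dotProduct,
    dotProduct_smul, smul_dotProduct, smul_eq_mul, ← h2] at h
  nlinarith

/-- Applying `T k`, evaluated at an affine function of `M⁻¹ A`, to the initial error changes it,
up to the factor `T k σ`, by an element of the search space. -/
theorem chebyshev_sub_mem_searchSpace (hM : M.PosDef) (hA : A.PosDef) {b x₀ x : n → ℝ}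
    (hx : A *ᵥ x = b) (σ ρ : ℝ) (k : ℕ) (hr : ∀ j < k, (pcgState M A b x₀ j).r ≠ 0) :
    aeval (σ • (1 : Module.End ℝ (n → ℝ)) - ρ • (M⁻¹ * A).mulVecLin) (T ℝ k) (x₀ - x)
      - (T ℝ k).eval σ • (x₀ - x) ∈ searchSpace M A b x₀ k := by
  induction k using Nat.twoStepInduction with
  | zero => simp
  | one =>
    have h0 : M⁻¹ *ᵥ (A *ᵥ (x₀ - x)) = -(pcgState M A b x₀ 0).p := by
      simp [pcgState, pcgInit, Matrix.mulVec_sub, hx]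
    have h1 : (pcgState M A b x₀ 0).p ∈ searchSpace M A b x₀ 1 := p_mem_searchSpace one_pos
    simp only [Nat.cast_one, T_one, aeval_X, eval_X, LinearMap.sub_apply, LinearMap.smul_apply,
      Module.End.one_apply, Matrix.mulVecLin_apply, ← Matrix.mulVec_mulVec, h0]
    rw [sub_sub_cancel_left, smul_neg, neg_neg]
    exact Submodule.smul_mem _ _ h1
  | more k ih0 ih1 =>
    have m0 := searchSpace_mono (show k ≤ k + 2 by omega) (ih0 fun j hj => hr j (by omega))
    have m1 := ih1 fun j hj => hr j (by omega)
    have m2 := mulVec_mem_searchSpace hM hA (k := k + 1) (fun j hj => hr j (by omega)) m1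
    have m1' := searchSpace_mono (show k + 1 ≤ k + 2 by omega) m1
    have h0 : M⁻¹ *ᵥ (A *ᵥ (x₀ - x)) = -(pcgState M A b x₀ 0).p := by
      simp [pcgState, pcgInit, Matrix.mulVec_sub, hx]
    have mp : (pcgState M A b x₀ 0).p ∈ searchSpace M A b x₀ (k + 2) :=
      p_mem_searchSpace (by omega)
    push_cast at m1 m2 m1' ⊢
    rw [T_add_two]
    generalize x₀ - x = e at *
    generalize hf : (σ • (1 : Module.End ℝ (n → ℝ)) - ρ • (M⁻¹ * A).mulVecLin) = f at *
    have hfy : ∀ y, f y = σ • y - ρ • M⁻¹ *ᵥ (A *ᵥ y) := by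
      intro y
      simp [← hf, Matrix.mulVec_mulVec]
    simp only [map_sub, map_mul, aeval_X, eval_sub, eval_mul, eval_X, eval_ofNat,
      LinearMap.sub_apply, Module.End.mul_apply, map_ofNat, Module.End.ofNat_apply] at m0 m1 m2 m1' ⊢
    rw [hfy]
    rw [Matrix.mulVec_sub, Matrix.mulVec_sub, Matrix.mulVec_smul, Matrix.mulVec_smul, h0] at m2
    have := sub_mem (sub_mem (add_mem (Submodule.smul_mem _ (2 * σ) m1')
      (Submodule.smul_mem _ (2 * ρ * (T ℝ (k + 1)).eval σ) mp)) (Submodule.smul_mem _ (2 * ρ) m2)) m0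
    convert this using 1
    module

/-- The Chebyshev estimate for the preconditioned conjugate gradient method, when the generalized
Rayleigh quotient of `(A, M)` takes its values in `[a, c]`. -/
theorem chebyshev_mul_energyNorm_le (hM : M.PosDef) (hA : A.PosDef) (ha₀ : 0 < a) (hac : a < c)
    (ha : ∀ y, a * (y ⬝ᵥ M *ᵥ y) ≤ y ⬝ᵥ A *ᵥ y) (hc : ∀ y, y ⬝ᵥ A *ᵥ y ≤ c * (y ⬝ᵥ M *ᵥ y))
    {b x : n → ℝ} (x₀ : n → ℝ) (hx : A *ᵥ x = b) (k : ℕ) :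
    (T ℝ k).eval ((c + a) / (c - a)) * energyNorm A (pcgIterate M A b x₀ k - x)
      ≤ energyNorm A (x₀ - x) := by
  have hAs := transpose_eq_of_posDef hA
  have hMs := transpose_eq_of_posDef hM.inv
  change _ * energyNorm A ((pcgState M A b x₀ k).x - x) ≤ _
  by_cases hr : ∀ j < k, (pcgState M A b x₀ j).r ≠ 0
  swap
  · -- the method has terminated with the exact solution
    push Not at hr
    obtain ⟨j, hj, hr⟩ := hr
    have h := pcgState_r_eq_zero_of_le hj.le hr
    rw [pcgState_residual, sub_eq_zero] at h
    simp [energyNorm, Matrix.mulVec_sub, hx, ← h]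
  set t := (T ℝ k).eval ((c + a) / (c - a))
  set e := (pcgState M A b x₀ k).x - x
  have hmem := chebyshev_sub_mem_searchSpace hM hA hx ((c + a) / (c - a)) (2 / (c - a)) k hr
  set f := ((c + a) / (c - a)) • (1 : Module.End ℝ (n → ℝ)) - (2 / (c - a)) • (M⁻¹ * A).mulVecLin
  set w := aeval f (T ℝ k) (x₀ - x)
  have hw : w - t • e ∈ searchSpace M A b x₀ k := by
    have h1 := sub_mem hmem (Submodule.smul_mem _ t (x_sub_mem_searchSpace (M := M) (A := A)
      (b := b) (x₀ := x₀) k))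
    convert h1 using 1
    simp only [e, t]
    module
  have horth := error_orthogonal hM hA hr hx hw
  -- `w = t e + (w - t e)` is an `A`-orthogonal decomposition
  have hpyth : t ^ 2 * (e ⬝ᵥ A *ᵥ e) ≤ w ⬝ᵥ A *ᵥ w := by
    have h1 := posDef_dotProduct_nonneg hA (w - t • e)
    have h2 : (w - t • e) ⬝ᵥ A *ᵥ (w - t • e) + t ^ 2 * (e ⬝ᵥ A *ᵥ e) = w ⬝ᵥ A *ᵥ w := by
      have h3 := dotProduct_mulVec_symm hAs w e
      change (w - t • e) ⬝ᵥ A *ᵥ e = 0 at horth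
      simp only [Matrix.mulVec_sub, Matrix.mulVec_smul, dotProduct_sub, sub_dotProduct,
        dotProduct_smul, smul_dotProduct, smul_eq_mul] at horth ⊢
      linear_combination (-2 * t) * horth + t * h3
    linarith
  have hwle : w ⬝ᵥ A *ᵥ w ≤ (x₀ - x) ⬝ᵥ A *ᵥ (x₀ - x) := by
    have hs : ∀ y z, Matrix.toBilin' A y z = Matrix.toBilin' A z y := by
      intro y z
      simpa [Matrix.toBilin'_apply'] using dotProduct_mulVec_symm hAs y z
    have hself : ∀ y z, Matrix.toBilin' A ((M⁻¹ * A).mulVecLin y) z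
        = Matrix.toBilin' A y ((M⁻¹ * A).mulVecLin z) := by
      intro y z
      simp only [Matrix.toBilin'_apply', Matrix.mulVecLin_apply, ← Matrix.mulVec_mulVec]
      rw [dotProduct_mulVec_symm hAs y, dotProduct_comm, dotProduct_comm (M⁻¹ *ᵥ _),
        dotProduct_mulVec_symm hMs]
    have hf : ∀ y, f y = ((c + a) / (c - a)) • y - (2 / (c - a)) • (M⁻¹ * A).mulVecLin y :=
      fun y => by simp [f]
    have := bilin_aeval_chebyshev_T_le (Matrix.toBilin' A) f (fun y z => by
        rw [hf, hf]
        simp only [map_sub, map_smul, LinearMap.sub_apply, LinearMap.smul_apply, hself])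
      (fun y => by
        rw [hf]
        refine bilin_affine_contraction _ _ hs hself hac (fun v => ?_) (fun v => ?_) y
        · simpa [Matrix.toBilin'_apply', Matrix.mulVec_mulVec] using
            precond_lower_bound hM ha₀ ha v
        · simpa [Matrix.toBilin'_apply', Matrix.mulVec_mulVec] using
            precond_upper_bound hM hA (ha₀.trans hac) hc v) k (x₀ - x)
    simpa only [Matrix.toBilin'_apply'] using this
  calc t * √(e ⬝ᵥ A *ᵥ e) ≤ |t| * √(e ⬝ᵥ A *ᵥ e) := by gcongr; exact le_abs_self t
    _ = √(t ^ 2 * (e ⬝ᵥ A *ᵥ e)) := by rw [Real.sqrt_mul (sq_nonneg t), Real.sqrt_sq_eq_abs]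
    _ ≤ √((x₀ - x) ⬝ᵥ A *ᵥ (x₀ - x)) := Real.sqrt_le_sqrt (hpyth.trans hwle)

/-- For condition number `4` the factor `(√κ - 1) / (√κ + 1)` is `1 / 3`. -/
theorem energyNorm_pcgIterate_le (hM : M.PosDef) (hA : A.PosDef) (ha₀ : 0 < a)
    (ha : ∀ y, a * (y ⬝ᵥ M *ᵥ y) ≤ y ⬝ᵥ A *ᵥ y)
    (hc : ∀ y, y ⬝ᵥ A *ᵥ y ≤ 4 * a * (y ⬝ᵥ M *ᵥ y))
    {b x : n → ℝ} (x₀ : n → ℝ) (hx : A *ᵥ x = b) (k : ℕ) :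
    energyNorm A (pcgIterate M A b x₀ k - x) ≤ 2 / 3 ^ k * energyNorm A (x₀ - x) := by
  have h := chebyshev_mul_energyNorm_le hM hA ha₀ (show a < 4 * a by linarith) ha hc x₀ hx k
  rw [show (4 * a + a) / (4 * a - a) = 5 / 3 by field_simp; norm_num,
    chebyshev_T_eval_five_thirds] at h
  have h0 : 0 ≤ energyNorm A (pcgIterate M A b x₀ k - x) := Real.sqrt_nonneg _
  have h1 : (0 : ℝ) < (1 / 3) ^ k := by positivity
  rw [div_mul_eq_mul_div, le_div_iff₀ (by positivity)]
  nlinarith [mul_nonneg h1.le h0]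

end TimeParallelPCG

/-! ### Spectral equivalence of the Schur complement and its preconditioner -/

namespace TimeParallelPCG

theorem dotProduct_self_nonneg' {n : Type*} [Fintype n] (x : n → ℝ) : 0 ≤ x ⬝ᵥ x :=
  Finset.sum_nonneg fun _ _ => mul_self_nonneg _

/-- The lower shift matrix, with ones on the first subdiagonal. -/
def lowerShift (N : ℕ) : Matrix (Fin N) (Fin N) ℝ :=
  Matrix.of fun i j => if (i : ℕ) = (j : ℕ) + 1 then 1 else 0

theorem B₁_eq (N : ℕ) : B₁ N = 1 - lowerShift N := by
  ext i j
  simp only [B₁, lowerShift, Matrix.of_apply, Matrix.sub_apply, Matrix.one_apply, Fin.ext_iff]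
  split_ifs <;> first | omega | norm_num

theorem B₂_eq (N : ℕ) : B₂ N = 1 + lowerShift N := by
  ext i j
  simp only [B₂, lowerShift, Matrix.of_apply, Matrix.add_apply, Matrix.one_apply, Fin.ext_iff]
  split_ifs <;> first | omega | norm_num

theorem lowerShift_transpose_contraction {N : ℕ} (y : Fin N → ℝ) :
    ((lowerShift N)ᵀ *ᵥ y) ⬝ᵥ ((lowerShift N)ᵀ *ᵥ y) ≤ y ⬝ᵥ y := by
  -- the extension of `y` by zero
  let y' : ℕ → ℝ := fun m => if h : m < N then y ⟨m, h⟩ else 0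
  have h1 : ∀ j : Fin N, ((lowerShift N)ᵀ *ᵥ y) j = y' (j + 1) := by
    intro j
    simp only [Matrix.mulVec, dotProduct, Matrix.transpose_apply, lowerShift, Matrix.of_apply,
      ite_mul, one_mul, zero_mul, y']
    split_ifs with h
    · rw [Finset.sum_eq_single ⟨j + 1, h⟩]
      · simp
      · intro i _ hi
        exact if_neg fun h' => hi (Fin.ext h')
      · simp
    · exact Finset.sum_eq_zero fun i _ => if_neg (by omega)
  have h2 : ∀ j : Fin N, y j = y' j := fun j => by simp [y']
  have h3 : y' N = 0 := by simp [y']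
  simp only [dotProduct, h1, h2]
  rw [Fin.sum_univ_eq_sum_range (fun m => y' (m + 1) * y' (m + 1)),
    Fin.sum_univ_eq_sum_range (fun m => y' m * y' m)]
  have h4 := Finset.sum_range_succ (fun m => y' m * y' m) N
  have h5 := Finset.sum_range_succ' (fun m => y' m * y' m) N
  rw [h3] at h4
  nlinarith [mul_self_nonneg (y' 0)]

/-- The Cayley transform `B = (1 + S)⁻¹ (1 - S)` of the shift `S` is accretive, because `S` is a
contraction. -/
theorem B_dotProduct_nonneg {N : ℕ} (x : Fin N → ℝ) : 0 ≤ x ⬝ᵥ B N *ᵥ x := by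
  have hu : IsUnit (B₂ N).det := by rw [det_B₂]; exact isUnit_one
  set y := ((B₂ N)⁻¹)ᵀ *ᵥ x
  have hx : x = (B₂ N)ᵀ *ᵥ y := by
    rw [Matrix.mulVec_mulVec, ← Matrix.transpose_mul, Matrix.nonsing_inv_mul _ hu]
    simp
  have h1 : x ⬝ᵥ B N *ᵥ x = ((B₁ N)ᵀ *ᵥ y) ⬝ᵥ x := by
    rw [B, ← Matrix.mulVec_mulVec, Matrix.dotProduct_mulVec, ← Matrix.mulVec_transpose,
      Matrix.dotProduct_mulVec, ← Matrix.mulVec_transpose]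
  rw [h1, hx, B₁_eq, B₂_eq]
  have h2 := lowerShift_transpose_contraction y
  have h3 := dotProduct_comm y ((lowerShift N)ᵀ *ᵥ y)
  simp only [Matrix.transpose_sub, Matrix.transpose_add, Matrix.transpose_one, Matrix.sub_mulVec,
    Matrix.add_mulVec, Matrix.one_mulVec, sub_dotProduct, dotProduct_add]
  linarith

theorem G_dotProduct_nonneg {N J : ℕ} {τ : ℝ} (hτ : 0 ≤ τ) {L : Matrix (Fin J) (Fin J) ℝ}
    (hL : L.PosSemidef) (x : Fin N × Fin J → ℝ) : 0 ≤ x ⬝ᵥ (G N J τ L)ᵀ *ᵥ x := by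
  have hB : (B N + (B N)ᵀ).PosSemidef := by
    refine .of_dotProduct_mulVec_nonneg ?_ fun y => ?_
    · rw [Matrix.IsHermitian, Matrix.conjTranspose_eq_transpose_of_trivial, Matrix.transpose_add,
        Matrix.transpose_transpose, add_comm]
    · have h1 := B_dotProduct_nonneg y
      have h2 : y ⬝ᵥ (B N)ᵀ *ᵥ y = y ⬝ᵥ B N *ᵥ y := by
        rw [Matrix.dotProduct_mulVec, Matrix.vecMul_transpose, dotProduct_comm]
      rw [star_trivial, Matrix.add_mulVec, dotProduct_add, h2]
      positivity
  have h1 := (hB.kronecker (Matrix.PosSemidef.one (n := Fin J) (R := ℝ))).dotProduct_mulVec_nonneg x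
  have h2 := ((Matrix.PosSemidef.one (n := Fin N) (R := ℝ)).kronecker hL).dotProduct_mulVec_nonneg x
  have h3 : x ⬝ᵥ (B N ⊗ₖ (1 : Matrix (Fin J) (Fin J) ℝ))ᵀ *ᵥ x
      = x ⬝ᵥ (B N ⊗ₖ (1 : Matrix (Fin J) (Fin J) ℝ)) *ᵥ x := by
    rw [Matrix.dotProduct_mulVec, Matrix.vecMul_transpose, dotProduct_comm]
  have h4 : (B N ⊗ₖ (1 : Matrix (Fin J) (Fin J) ℝ))ᵀ = (B N)ᵀ ⊗ₖ 1 := by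
    rw [← Matrix.kroneckerMap_transpose, Matrix.transpose_one]
  rw [star_trivial, Matrix.add_kronecker, Matrix.add_mulVec, dotProduct_add, ← h4, h3] at h1
  rw [star_trivial] at h2
  rw [Matrix.dotProduct_mulVec, Matrix.vecMul_transpose, dotProduct_comm, G,
    Matrix.smul_kronecker, Matrix.add_mulVec, Matrix.smul_mulVec, Matrix.smul_mulVec,
    dotProduct_add, dotProduct_smul, dotProduct_smul, smul_eq_mul, smul_eq_mul]
  have := mul_nonneg hτ h2
  linarith

/-- The operator norm of `C ⊗ 1` is at most the Frobenius norm of `C`. -/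
theorem kronecker_one_transpose_mulVec_le {m n : Type*} [Fintype m] [Fintype n] [DecidableEq n]
    (C : Matrix m m ℝ) (x : m × n → ℝ) :
    ((C ⊗ₖ (1 : Matrix n n ℝ))ᵀ *ᵥ x) ⬝ᵥ ((C ⊗ₖ (1 : Matrix n n ℝ))ᵀ *ᵥ x)
      ≤ (∑ i, ∑ j, C i j ^ 2) * (x ⬝ᵥ x) := by
  have h : ∀ j s, ((C ⊗ₖ (1 : Matrix n n ℝ))ᵀ *ᵥ x) (j, s) = ∑ i, C i j * x (i, s) := by
    intro j s
    simp [Matrix.mulVec, dotProduct, Fintype.sum_prod_type, Matrix.one_apply]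
  simp only [dotProduct, Fintype.sum_prod_type, h, ← pow_two]
  calc ∑ j, ∑ s, (∑ i, C i j * x (i, s)) ^ 2
      ≤ ∑ j, ∑ s, (∑ i, C i j ^ 2) * ∑ i, x (i, s) ^ 2 := by
        gcongr
        exact Finset.sum_mul_sq_le_sq_mul_sq _ _ _
    _ = (∑ i, ∑ j, C i j ^ 2) * ∑ i, ∑ s, x (i, s) ^ 2 := by
        simp only [← Finset.mul_sum, ← Finset.sum_mul]
        rw [Finset.sum_comm, Finset.sum_comm (f := fun i s => x (i, s) ^ 2)]

theorem Btilde_frobenius_le (N : ℕ) : ∑ i, ∑ j, Btilde N i j ^ 2 ≤ 2 * (N : ℝ) ^ 2 := by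
  have hent : ∀ i j : Fin N, Btilde N i j ^ 2 = if i < j then (4 : ℝ) else 0 := by
    intro i j
    simp only [Btilde, Matrix.of_apply, Fin.lt_def]
    split_ifs with h
    · rw [q, if_neg (by omega), mul_pow, ← pow_mul, mul_comm _ 2, pow_mul]
      norm_num
    · norm_num
  simp only [hent]
  have hsymm : ∑ i : Fin N, ∑ j : Fin N, (if i < j then (4 : ℝ) else 0)
      = ∑ i : Fin N, ∑ j : Fin N, (if j < i then (4 : ℝ) else 0) := Finset.sum_comm
  have hsum : ∑ i : Fin N, ∑ j : Fin N, (if i < j then (4 : ℝ) else 0)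
      + ∑ i : Fin N, ∑ j : Fin N, (if j < i then (4 : ℝ) else 0)
      ≤ ∑ i : Fin N, ∑ j : Fin N, (4 : ℝ) := by
    simp only [← Finset.sum_add_distrib]
    gcongr with i _ j _
    split_ifs with h h' <;> first | exact absurd h h'.asymm | norm_num
  simp only [Finset.sum_const, Finset.card_univ, Fintype.card_fin, nsmul_eq_mul] at hsum hsymm
  nlinarith

theorem Ralpha_eq (N J : ℕ) (τ γ α : ℝ) (L : Matrix (Fin J) (Fin J) ℝ) :
    Ralpha N J τ γ α L = √τ • (1 : Matrix (Fin N × Fin J) (Fin N × Fin J) ℝ)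
      + √(γ / τ) • G N J τ L
      + (2 * √(γ / τ) * α) • (Btilde N ⊗ₖ (1 : Matrix (Fin J) (Fin J) ℝ)) := by
  simp only [Ralpha, G, Balpha, Matrix.add_kronecker, Matrix.smul_kronecker, Matrix.one_kronecker_one,
    smul_add]
  module

/-- Perturbation estimate behind the condition number `4`: with `ε = 5 / 24`, so that
`1 / 24 ≤ ε ^ 2`, one has `(1 - ε) ^ 2 (|a|² + |g|²) ≤ |a + g + e|²` and
`|a + g + e|² ≤ ((1 + ε) ^ 2 + 1) (|a|² + |g|²) ≤ 4 (1 - ε) ^ 2 (|a|² + |g|²)`. -/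
theorem perturbed_sum_bounds {n : Type*} [Fintype n] (a g e : n → ℝ) (hag : 0 ≤ a ⬝ᵥ g)
    (he : e ⬝ᵥ e ≤ 1 / 24 * (a ⬝ᵥ a)) :
    361 / 576 * (a ⬝ᵥ a + g ⬝ᵥ g) ≤ (a + g + e) ⬝ᵥ (a + g + e) ∧
    (a + g + e) ⬝ᵥ (a + g + e) ≤ 361 / 144 * (a ⬝ᵥ a + g ⬝ᵥ g) := by
  -- Young's inequality: for `(a + g) + e` with weight `ε`, for `a + e` with weight `ε`, and for
  -- `(a + e) + g` with weight `(1 + ε) ^ (-2)`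
  have h1 := dotProduct_self_nonneg' ((5 / 24 : ℝ) • (a + g) + e)
  have h2 := dotProduct_self_nonneg' ((5 / 24 : ℝ) • a - e)
  have h3 := dotProduct_self_nonneg' ((24 / 29 : ℝ) • (a + e) - (29 / 24 : ℝ) • g)
  have ha := dotProduct_self_nonneg' a
  have hg := dotProduct_self_nonneg' g
  have c1 := dotProduct_comm g a
  have c2 := dotProduct_comm e a
  have c3 := dotProduct_comm e g
  simp only [dotProduct_add, add_dotProduct, dotProduct_sub, sub_dotProduct, smul_dotProduct,
    dotProduct_smul, smul_eq_mul, c1, c2, c3] at h1 h2 h3 ⊢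
  constructor <;> linarith

theorem K_dotProduct (N J : ℕ) (τ γ : ℝ) (L : Matrix (Fin J) (Fin J) ℝ) (x : Fin N × Fin J → ℝ) :
    x ⬝ᵥ K N J τ γ L *ᵥ x
      = τ * (x ⬝ᵥ x) + γ / τ * (((G N J τ L)ᵀ *ᵥ x) ⬝ᵥ ((G N J τ L)ᵀ *ᵥ x)) := by
  rw [K, Matrix.add_mulVec, Matrix.smul_mulVec, Matrix.smul_mulVec, Matrix.one_mulVec,
    ← Matrix.mulVec_mulVec, dotProduct_add, dotProduct_smul, dotProduct_smul,
    Matrix.dotProduct_mulVec x (G N J τ L), ← Matrix.mulVec_transpose, smul_eq_mul, smul_eq_mul]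

theorem Palpha_dotProduct (N J : ℕ) (τ γ α : ℝ) (L : Matrix (Fin J) (Fin J) ℝ)
    (x : Fin N × Fin J → ℝ) :
    x ⬝ᵥ Palpha N J τ γ α L *ᵥ x
      = ((Ralpha N J τ γ α L)ᵀ *ᵥ x) ⬝ᵥ ((Ralpha N J τ γ α L)ᵀ *ᵥ x) := by
  rw [Palpha, ← Matrix.mulVec_mulVec, Matrix.dotProduct_mulVec x (Ralpha N J τ γ α L),
    ← Matrix.mulVec_transpose]

theorem K_posDef (N J : ℕ) {τ γ : ℝ} (hτ : 0 < τ) (hγ : 0 < γ) (L : Matrix (Fin J) (Fin J) ℝ) :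
    (K N J τ γ L).PosDef := by
  refine (Matrix.PosDef.one.smul hτ).add_posSemidef (Matrix.PosSemidef.smul ?_ (by positivity))
  simpa using Matrix.posSemidef_self_mul_conjTranspose (G N J τ L)

/-- The preconditioner and the Schur complement are spectrally equivalent, with ratio `4` of the
equivalence constants. -/
theorem Palpha_bounds {N J : ℕ} {τ γ α : ℝ} (hτ : 0 < τ) (hγ : 0 < γ)
    {L : Matrix (Fin J) (Fin J) ℝ} (hL : L.PosSemidef)
    (hα : 192 * γ * (N : ℝ) ^ 2 * α ^ 2 ≤ τ ^ 2) (x : Fin N × Fin J → ℝ) :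
    361 / 576 * (x ⬝ᵥ K N J τ γ L *ᵥ x) ≤ x ⬝ᵥ Palpha N J τ γ α L *ᵥ x ∧
    x ⬝ᵥ Palpha N J τ γ α L *ᵥ x ≤ 361 / 144 * (x ⬝ᵥ K N J τ γ L *ᵥ x) := by
  have hη : 0 < γ / τ := div_pos hγ hτ
  set y := (G N J τ L)ᵀ *ᵥ x
  set z := (Btilde N ⊗ₖ (1 : Matrix (Fin J) (Fin J) ℝ))ᵀ *ᵥ x
  have hR : (Ralpha N J τ γ α L)ᵀ *ᵥ x
      = √τ • x + √(γ / τ) • y + (2 * √(γ / τ) * α) • z := by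
    simp only [Ralpha_eq, Matrix.transpose_add, Matrix.transpose_smul, Matrix.transpose_one,
      Matrix.add_mulVec, Matrix.smul_mulVec, Matrix.one_mulVec, y, z]
  have hsq : ∀ (c : ℝ) (w : Fin N × Fin J → ℝ), (c • w) ⬝ᵥ (c • w) = c ^ 2 * (w ⬝ᵥ w) := by
    intro c w
    rw [smul_dotProduct, dotProduct_smul, smul_eq_mul, smul_eq_mul]
    ring
  have hxx := dotProduct_self_nonneg' x
  have hz : z ⬝ᵥ z ≤ 2 * (N : ℝ) ^ 2 * (x ⬝ᵥ x) :=
    (kronecker_one_transpose_mulVec_le _ x).trans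
      (mul_le_mul_of_nonneg_right (Btilde_frobenius_le N) hxx)
  have h := perturbed_sum_bounds (√τ • x) (√(γ / τ) • y) ((2 * √(γ / τ) * α) • z)
    (by
      rw [smul_dotProduct, dotProduct_smul, smul_eq_mul, smul_eq_mul]
      have := G_dotProduct_nonneg hτ.le hL x
      positivity)
    (by
      rw [hsq, hsq, Real.sq_sqrt hτ.le, mul_pow, mul_pow, Real.sq_sqrt hη.le]
      calc 2 ^ 2 * (γ / τ) * α ^ 2 * (z ⬝ᵥ z)
          ≤ 2 ^ 2 * (γ / τ) * α ^ 2 * (2 * (N : ℝ) ^ 2 * (x ⬝ᵥ x)) := by gcongr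
        _ = 192 * γ * (N : ℝ) ^ 2 * α ^ 2 * (x ⬝ᵥ x) / (24 * τ) := by field_simp; ring
        _ ≤ τ ^ 2 * (x ⬝ᵥ x) / (24 * τ) := by gcongr
        _ = 1 / 24 * (τ * (x ⬝ᵥ x)) := by field_simp)
  rw [hsq √τ, hsq √(γ / τ), Real.sq_sqrt hτ.le, Real.sq_sqrt hη.le] at h
  rw [K_dotProduct, Palpha_dotProduct, hR]
  exact h

theorem Palpha_posDef {N J : ℕ} {τ γ α : ℝ} (hτ : 0 < τ) (hγ : 0 < γ)
    {L : Matrix (Fin J) (Fin J) ℝ} (hL : L.PosSemidef)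
    (hα : 192 * γ * (N : ℝ) ^ 2 * α ^ 2 ≤ τ ^ 2) : (Palpha N J τ γ α L).PosDef := by
  refine .of_dotProduct_mulVec_pos ?_ fun x hx => ?_
  · rw [Matrix.IsHermitian, Matrix.conjTranspose_eq_transpose_of_trivial, Palpha,
      Matrix.transpose_mul, Matrix.transpose_transpose]
  · have h1 := (Palpha_bounds hτ hγ hL hα x).1
    have h2 := posDef_dotProduct_pos (K_posDef N J hτ hγ L) hx
    rw [star_trivial]
    linarith

end TimeParallelPCG

/-! ### The convergence rate -/

theorem theorem3p3 (N J : ℕ) (hN : 0 < N) (T τ γ α : ℝ) (hT : 0 < T) (hτ : τ = T / (N : ℝ))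
    (hγ : 0 < γ) (L : Matrix (Fin J) (Fin J) ℝ) (hL : L.PosSemidef)
    (hα : α ∈ Set.Ioc (0 : ℝ)
      (min (τ / (24 * √γ))
        (min (τ ^ (3 / 2 : ℝ) / (2 * √(6 * γ) * T))
          (min (τ ^ 2 / (8 * √(3 * γ) * T)) (1 / 3))))) :
    (TimeParallelPCG.K N J τ γ L).PosDef ∧
    (TimeParallelPCG.Palpha N J τ γ α L).PosDef ∧
    ∀ b v v₀ : Fin N × Fin J → ℝ,
      ((TimeParallelPCG.Palpha N J τ γ α L)⁻¹ * TimeParallelPCG.K N J τ γ L) *ᵥ v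
          = (TimeParallelPCG.Palpha N J τ γ α L)⁻¹ *ᵥ b →
      ∀ k : ℕ,
        TimeParallelPCG.energyNorm (TimeParallelPCG.K N J τ γ L)
            (TimeParallelPCG.pcgIterate (TimeParallelPCG.Palpha N J τ γ α L)
              (TimeParallelPCG.K N J τ γ L) b v₀ k - v)
          ≤ 2 / 3 ^ k * TimeParallelPCG.energyNorm (TimeParallelPCG.K N J τ γ L) (v₀ - v) := by
  have hN' : (0 : ℝ) < N := Nat.cast_pos.2 hN
  have hτ₀ : 0 < τ := hτ ▸ div_pos hT hN'
  have hα₀ : 0 < α := hα.1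
  have hα' : 192 * γ * (N : ℝ) ^ 2 * α ^ 2 ≤ τ ^ 2 := by
    -- only the third of the four bounds on `α` is needed
    have h1 : α ≤ τ ^ 2 / (8 * √(3 * γ) * T) :=
      (le_min_iff.1 (le_min_iff.1 (le_min_iff.1 hα.2).2).2).1
    have hTN : T = N * τ := by rw [hτ]; field_simp
    have h3 : 0 < √(3 * γ) := Real.sqrt_pos.2 (by positivity)
    rw [le_div_iff₀ (by positivity), hTN] at h1
    have h4 : 8 * √(3 * γ) * N * α ≤ τ := by
      refine le_of_mul_le_mul_right ?_ hτ₀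
      linarith
    have h5 := pow_le_pow_left₀ (by positivity) h4 2
    simp only [mul_pow, Real.sq_sqrt (show 0 ≤ 3 * γ by positivity)] at h5
    linarith
  have hK := TimeParallelPCG.K_posDef N J hτ₀ hγ L
  have hP := TimeParallelPCG.Palpha_posDef (J := J) hτ₀ hγ hL hα'
  refine ⟨hK, hP, fun b v v₀ hv k => ?_⟩
  have hv' : TimeParallelPCG.K N J τ γ L *ᵥ v = b := by
    have h := congrArg (TimeParallelPCG.Palpha N J τ γ α L *ᵥ ·) hv
    simpa only [Matrix.mulVec_mulVec, ← Matrix.mul_assoc,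
      Matrix.mul_nonsing_inv _ ((Matrix.isUnit_iff_isUnit_det _).1 hP.isUnit), Matrix.one_mul,
      Matrix.one_mulVec] using h
  refine TimeParallelPCG.energyNorm_pcgIterate_le (a := 144 / 361) hP hK (by norm_num)
    (fun y => ?_) (fun y => ?_) v₀ hv' k
  · linarith [(TimeParallelPCG.Palpha_bounds hτ₀ hγ hL hα' y).2]
  · linarith [(TimeParallelPCG.Palpha_bounds hτ₀ hγ hL hα' y).1]
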